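/- **Setting.** Let $\mathcal H_{\rm in},\mathcal H_{\rm out}$ be finite-dimensional complex Hilbert spaces and let $\{\Phi_\theta\}_{\theta\in\mathbb R}$ be a family of quantum channels (completely positive trace preserving linear maps) from $\mathcal H_{\rm in}$ to $\mathcal H_{\rm out}$. An *adaptive estimator* is a sequence, indexed by the number $n\ge 1$ of channel uses, of the following data: an ancilla Hilbert space $\mathcal K^n$ (of any dimension), a density operator $\rho^n$ on $\mathcal H_{\rm in}\otimes\mathcal K^n$, a channel $\Psi^n_1$ from $\mathcal H_{\rm in}\otimes\mathcal K^n$ to itself, channels $\Psi^n_2,\dots,\Psi^n_n$ from $\mathcal H_{\rm out}\otimes\mathcal K^n$ to $\mathcal H_{\rm in}\otimes\mathcal K^n$, and a positive operator valued measure $M^n$ on the Borel sets of $\mathbb R$ acting on $\mathcal H_{\rm out}\otimes\mathcal K^n$. When the channel is $\Phi_\theta$, the estimate $\hat\theta^n$ is the outcome of measuring $M^n$ in the state $$(\Phi_\theta\otimes \mathbf I)\circ\Psi^n_n\circ\cdots\circ(\Phi_\theta\otimes \mathbf I)\circ\Psi^n_1\,(\rho^n),$$ and $\mathbb E_\theta$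 denotes expectation with respect to its distribution. The estimator is *asymptotically unbiased* at $\theta$ if, for all large $n$, $\mathbb E_{t}[\hat\theta^n]$ exists for $t$ near $\theta$ and is differentiable in $t$ at $\theta$, and $$\lim_{n\to\infty}\mathbb E_\theta[\hat\theta^n]=\theta,\qquad \lim_{n\to\infty}\frac{\mathrm d}{\mathrm dt}\mathbb E_t[\hat\theta^n]\Big|_{t=\theta}=1 .$$ **Theorem.** Let $\theta\in\mathbb R$, suppose that $t\mapsto\Phi_t$ is differentiable at $\theta$, and that there is $\varepsilon_\theta>0$ such that both $\Phi_\theta+\varepsilon_\theta\,\mathrm d\Phi_\theta/\mathrm d\theta$ and $\Phi_\theta-\varepsilon_\theta\,\mathrm d\Phi_\theta/\mathrm d\theta$ are completely positive. Then every adaptive estimator that is asymptotically unbiased at $\theta$ satisfies $$\liminf_{n\to\infty}\; n\,\mathbb E_\theta\big[(\hat\theta^n-\theta)^2\big]\;\ge\;\varepsilon_\theta^{2}.$$ So its mean square error (possibly infinite) cannot decrease faster than order $1/n$; in particular the Heisenberg rate $1/n^2$ is impossible: for every constant $C$ one has $\mathbb E_\theta[(\hat\theta^n-\theta)^2]>C/n^2$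 for all sufficiently large $n$. If the hypotheses hold at every $\theta$, the conclusion holds at every $\theta$. -/

import Mathlib

open scoped InnerProductSpace ENNReal NNReal Topology ComplexOrder

noncomputable section

namespace ChannelEstimation

/-! ### Trace class operators and density operators on a complex Hilbert space -/

section TraceClass

set_option linter.unusedSectionVars false

variable {H H₁ H₂ : Type*}
  [NormedAddCommGroup H] [InnerProductSpace ℂ H]
  [NormedAddCommGroup H₁] [InnerProductSpace ℂ H₁]
  [NormedAddCommGroup H₂] [InnerProductSpace ℂ H₂]

/-- `T = ∑ n, |x n⟩⟨y n|` with `∑ n, ‖x n‖ * ‖y n‖ < ∞`. -/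
def IsNuclearSum (T : H →L[ℂ] H) (x y : ℕ → H) : Prop :=
  Summable (fun n => ‖x n‖ * ‖y n‖) ∧ ∀ v, HasSum (fun n => ⟪y n, v⟫_ℂ • x n) (T v)

/-- Trace class operators: those with a representation `T = ∑ n, |x n⟩⟨y n|`,
`∑ n, ‖x n‖ * ‖y n‖ < ∞`. -/
def IsTraceClass (T : H →L[ℂ] H) : Prop := ∃ x y : ℕ → H, IsNuclearSum T x y

theorem IsTraceClass.add {S T : H →L[ℂ] H} (hS : IsTraceClass S) (hT : IsTraceClass T) :
    IsTraceClass (S + T) := by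
  obtain ⟨x, y, h1, h2⟩ := hS
  obtain ⟨x', y', h1', h2'⟩ := hT
  have e : ∀ k : ℕ, (2 * k + 1) / 2 = k := fun k => by omega
  refine ⟨fun n => if n % 2 = 0 then x (n / 2) else x' (n / 2),
    fun n => if n % 2 = 0 then y (n / 2) else y' (n / 2), ?_, fun v => ?_⟩
  · refine (HasSum.even_add_odd (m := ∑' n, ‖x n‖ * ‖y n‖) (m' := ∑' n, ‖x' n‖ * ‖y' n‖)
      ?_ ?_).summable
    · simpa using h1.hasSum
    · simpa [Nat.add_mod, e] using h1'.hasSum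
  · refine HasSum.even_add_odd ?_ ?_
    · simpa using h2 v
    · simpa [Nat.add_mod, e] using h2' v

/-- The space of trace class operators on `H`. -/
def traceClass (H : Type*) [NormedAddCommGroup H] [InnerProductSpace ℂ H] :
    Submodule ℂ (H →L[ℂ] H) where
  carrier := {T | IsTraceClass T}
  zero_mem' := ⟨fun _ => 0, fun _ => 0, by simp, fun v => by
    simp⟩
  add_mem' hS hT := hS.add hT
  smul_mem' c T := by
    rintro ⟨x, y, h1, h2⟩
    refine ⟨fun n => c • x n, y, ?_, fun v => ?_⟩
    · simpa [norm_smul, mul_assoc] using h1.mul_left ‖c‖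
    · simpa [smul_comm c] using (h2 v).const_smul c

theorem mem_traceClass {T : H →L[ℂ] H} : T ∈ traceClass H ↔ IsTraceClass T := Iff.rfl

/-- The matrix `(X i j)` is a positive operator on the `m`-fold direct sum of `H`. -/
def BlockPositive {m : ℕ} (X : Fin m → Fin m → traceClass H) : Prop :=
  ∀ v : Fin m → H, 0 ≤ ∑ i, ∑ j, ⟪v i, (X i j).1 (v j)⟫_ℂ

variable [CompleteSpace H] [CompleteSpace H₁] [CompleteSpace H₂]

theorem IsNuclearSum.conj {T : H₁ →L[ℂ] H₁} {x y : ℕ → H₁} (h : IsNuclearSum T x y)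
    (V : H₁ →L[ℂ] H₂) (W : H₂ →L[ℂ] H₁) :
    IsNuclearSum (V ∘L T ∘L W) (fun n => V (x n)) (fun n => W.adjoint (y n)) := by
  refine ⟨?_, fun v => ?_⟩
  · refine Summable.of_nonneg_of_le (fun n => by positivity) (fun n => ?_)
      (h.1.mul_left (‖V‖ * ‖W.adjoint‖))
    calc ‖V (x n)‖ * ‖W.adjoint (y n)‖ ≤ (‖V‖ * ‖x n‖) * (‖W.adjoint‖ * ‖y n‖) := by
          gcongr <;> exact ContinuousLinearMap.le_opNorm _ _
      _ = _ := by ring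
  · simpa [ContinuousLinearMap.adjoint_inner_left] using (h.2 (W v)).mapL V

theorem IsTraceClass.conj {T : H₁ →L[ℂ] H₁} (h : IsTraceClass T)
    (V : H₁ →L[ℂ] H₂) (W : H₂ →L[ℂ] H₁) : IsTraceClass (V ∘L T ∘L W) := by
  obtain ⟨x, y, h⟩ := h
  exact ⟨_, _, h.conj V W⟩

/-- The trace `∑ i, ⟨e i, T (e i)⟩`, over some Hilbert basis `e` of `H`. -/
def trace (T : H →L[ℂ] H) : ℂ :=
  ∑' i, ⟪(exists_hilbertBasis ℂ H).choose_spec.choose i,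
    T ((exists_hilbertBasis ℂ H).choose_spec.choose i)⟫_ℂ

theorem hasSum_swap {ι : Type*} (F : ℕ → ι → ℂ) {c : ℕ → ℝ} (hc : Summable c)
    (bound : ∀ (n : ℕ) (s : Finset ι), ∑ i ∈ s, ‖F n i‖ ≤ c n) :
    HasSum (fun i => ∑' n, F n i) (∑' n, ∑' i, F n i) := by
  have hrow : ∀ n, Summable fun i => ‖F n i‖ := fun n =>
    summable_of_sum_le (fun i => norm_nonneg _) (bound n)
  have hsum : Summable (Function.uncurry F) := by
    refine Summable.of_norm ((summable_prod_of_nonneg (fun p => norm_nonneg _)).2 ⟨hrow, ?_⟩)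
    exact Summable.of_nonneg_of_le (fun n => tsum_nonneg fun i => norm_nonneg _)
      (fun n => (hrow n).tsum_le_of_sum_le (bound n)) hc
  rw [← hsum.tsum_comm]
  exact hsum.prod_symm.prod.hasSum

/-- The trace can be computed in every Hilbert basis and from every nuclear representation. -/
theorem IsNuclearSum.hasSum_trace {T : H →L[ℂ] H} {x y : ℕ → H} (h : IsNuclearSum T x y)
    {ι : Type*} (e : HilbertBasis ι ℂ H) :
    HasSum (fun i => ⟪e i, T (e i)⟫_ℂ) (∑' n, ⟪y n, x n⟫_ℂ) := by
  have bound : ∀ (n : ℕ) (s : Finset ι),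
      ∑ i ∈ s, ‖⟪y n, e i⟫_ℂ * ⟪e i, x n⟫_ℂ‖ ≤ ‖x n‖ * ‖y n‖ := by
    intro n s
    have h1 : ∑ i ∈ s, ‖⟪y n, e i⟫_ℂ‖ ^ 2 ≤ ‖y n‖ ^ 2 := by
      simpa only [norm_inner_symm] using e.orthonormal.sum_inner_products_le (x := y n) (s := s)
    have h2 : ∑ i ∈ s, ‖⟪e i, x n⟫_ℂ‖ ^ 2 ≤ ‖x n‖ ^ 2 :=
      e.orthonormal.sum_inner_products_le (x := x n) (s := s)
    calc ∑ i ∈ s, ‖⟪y n, e i⟫_ℂ * ⟪e i, x n⟫_ℂ‖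
        = ∑ i ∈ s, ‖⟪y n, e i⟫_ℂ‖ * ‖⟪e i, x n⟫_ℂ‖ := by simp
      _ ≤ √(∑ i ∈ s, ‖⟪y n, e i⟫_ℂ‖ ^ 2) * √(∑ i ∈ s, ‖⟪e i, x n⟫_ℂ‖ ^ 2) :=
          Real.sum_mul_le_sqrt_mul_sqrt _ _ _
      _ ≤ √(‖y n‖ ^ 2) * √(‖x n‖ ^ 2) := by gcongr
      _ = ‖x n‖ * ‖y n‖ := by
          rw [Real.sqrt_sq (norm_nonneg _), Real.sqrt_sq (norm_nonneg _), mul_comm]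
  have key := hasSum_swap (fun n i => ⟪y n, e i⟫_ℂ * ⟪e i, x n⟫_ℂ) h.1 bound
  simp only [e.tsum_inner_mul_inner] at key
  convert key using 2 with i
  have := (h.2 (e i)).mapL (innerSL ℂ (e i))
  exact (by simpa [inner_smul_right] using this : HasSum _ _).tsum_eq.symm

theorem IsNuclearSum.trace_eq {T : H →L[ℂ] H} {x y : ℕ → H} (h : IsNuclearSum T x y) :
    trace T = ∑' n, ⟪y n, x n⟫_ℂ := (h.hasSum_trace _).tsum_eq

theorem IsTraceClass.hasSum_trace {T : H →L[ℂ] H} (h : IsTraceClass T)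
    {ι : Type*} (e : HilbertBasis ι ℂ H) : HasSum (fun i => ⟪e i, T (e i)⟫_ℂ) (trace T) := by
  obtain ⟨x, y, h⟩ := h
  rw [h.trace_eq]
  exact h.hasSum_trace e

theorem trace_add {S T : H →L[ℂ] H} (hS : IsTraceClass S) (hT : IsTraceClass T) :
    trace (S + T) = trace S + trace T := by
  obtain ⟨w, e, -⟩ := exists_hilbertBasis ℂ H
  have := (hS.hasSum_trace e).add (hT.hasSum_trace e)
  refine ((hS.add hT).hasSum_trace e).unique ?_
  simpa [inner_add_right] using this

theorem trace_smul (c : ℂ) {T : H →L[ℂ] H} (hT : IsTraceClass T) :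
    trace (c • T) = c * trace T := by
  obtain ⟨w, e, -⟩ := exists_hilbertBasis ℂ H
  refine (((traceClass H).smul_mem c hT : IsTraceClass _).hasSum_trace e).unique ?_
  simpa [inner_smul_right] using (hT.hasSum_trace e).mul_left c

/-- Cyclicity of the trace. -/
theorem trace_conj {T : H₁ →L[ℂ] H₁} (h : IsTraceClass T)
    (V : H₁ →L[ℂ] H₂) (W : H₂ →L[ℂ] H₁) : trace (V ∘L T ∘L W) = trace (W ∘L V ∘L T) := by
  obtain ⟨x, y, h⟩ := h
  have h2 := h.conj (W ∘L V) (ContinuousLinearMap.id ℂ H₁)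
  rw [(h.conj V W).trace_eq]
  rw [show W ∘L V ∘L T = (W ∘L V) ∘L T ∘L ContinuousLinearMap.id ℂ H₁ from rfl, h2.trace_eq]
  simp [ContinuousLinearMap.adjoint_inner_left]

/-- The trace as a linear functional on the trace class. -/
def traceₗ (H : Type*) [NormedAddCommGroup H] [InnerProductSpace ℂ H] [CompleteSpace H] :
    traceClass H →ₗ[ℂ] ℂ where
  toFun T := trace T.1
  map_add' S T := trace_add S.2 T.2
  map_smul' c T := trace_smul c T.2

theorem isPositive_iff_inner {T : H →L[ℂ] H} : T.IsPositive ↔ ∀ v, 0 ≤ ⟪v, T v⟫_ℂ := by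
  refine ⟨fun h v => h.inner_nonneg_right v, fun h => ?_⟩
  have h' : ∀ v, ⟪T v, v⟫_ℂ = ⟪v, T v⟫_ℂ := fun v => by
    rw [← inner_conj_symm, Complex.conj_eq_iff_im.2 (Complex.nonneg_iff.1 (h v)).2.symm]
  exact (ContinuousLinearMap.isPositive_iff _).2
    ⟨(LinearMap.isSymmetric_iff_inner_map_self_real (T : H →ₗ[ℂ] H)).2 fun v => by
      simpa [inner_conj_symm] using (h' v).symm, fun v => by rw [h' v]; exact h v⟩

/-- A density operator: a positive trace class operator of trace one. -/
structure IsDensity (σ : traceClass H) : Prop where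
  isPositive : σ.1.IsPositive
  trace_eq_one : trace σ.1 = 1

/-- Quantum states on `H`, that is, density operators. -/
def DensityOperator (H : Type*) [NormedAddCommGroup H] [InnerProductSpace ℂ H] [CompleteSpace H] :=
  {σ : traceClass H // IsDensity σ}

/-- A quantum channel from `H₁` to `H₂`: a completely positive trace preserving linear map
between the trace classes. -/
structure QuantumChannel (H₁ H₂ : Type*)
    [NormedAddCommGroup H₁] [InnerProductSpace ℂ H₁] [CompleteSpace H₁]
    [NormedAddCommGroup H₂] [InnerProductSpace ℂ H₂] [CompleteSpace H₂] where
  toLinearMap : traceClass H₁ →ₗ[ℂ] traceClass H₂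
  completelyPositive : ∀ (m : ℕ) (X : Fin m → Fin m → traceClass H₁),
    BlockPositive X → BlockPositive fun i j => toLinearMap (X i j)
  trace_preserving : ∀ X, trace (toLinearMap X).1 = trace X.1

/-- A channel maps states to states. -/
def QuantumChannel.apply (Ψ : QuantumChannel H₁ H₂) (σ : DensityOperator H₁) :
    DensityOperator H₂ :=
  ⟨Ψ.toLinearMap σ.1, isPositive_iff_inner.2 fun v => by
      simpa using Ψ.completelyPositive 1 (fun _ _ => σ.1)
        (fun v => by simpa using isPositive_iff_inner.1 σ.2.isPositive (v 0)) (fun _ => v),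
    (Ψ.trace_preserving _).trans σ.2.trace_eq_one⟩

end TraceClass

/-! ### Real valued measurements -/

section Measurement

set_option linter.unusedSectionVars false

/-- A measurement on `H` with values in `ℝ`: a positive operator valued measure on the Borel
sets of `ℝ`, countably additive in the weak operator topology. -/
structure POVM (H : Type*) [NormedAddCommGroup H] [InnerProductSpace ℂ H] where
  toFun : Set ℝ → H →L[ℂ] H
  isPositive : ∀ B, MeasurableSet B → (toFun B).IsPositive
  univ : toFun Set.univ = ContinuousLinearMap.id ℂ H
  hasSum_iUnion : ∀ f : ℕ → Set ℝ, (∀ i, MeasurableSet (f i)) →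
    Pairwise (Function.onFun Disjoint f) →
      ∀ v w, HasSum (fun i => ⟪v, toFun (f i) w⟫_ℂ) ⟪v, toFun (⋃ i, f i) w⟫_ℂ

variable {H : Type*} [NormedAddCommGroup H] [InnerProductSpace ℂ H] [CompleteSpace H]

theorem exists_sqrt {T : H →L[ℂ] H} (hT : T.IsPositive) :
    ∃ S : H →L[ℂ] H, S.adjoint = S ∧ S ∘L S = T := by
  have h0 : 0 ≤ T := ContinuousLinearMap.nonneg_iff_isPositive T |>.2 hT
  exact ⟨CFC.sqrt T, (CFC.sqrt_nonneg T).isSelfAdjoint, CFC.sqrt_mul_sqrt_self T h0⟩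

theorem trace_mul_nonneg {S T : H →L[ℂ] H} (hS : S.IsPositive) (hT : T.IsPositive)
    (hT' : IsTraceClass T) : 0 ≤ trace (S ∘L T) := by
  obtain ⟨R, hR, rfl⟩ := exists_sqrt hS
  rw [ContinuousLinearMap.comp_assoc, ← trace_conj hT' R R]
  refine tsum_nonneg fun i => ?_
  have := isPositive_iff_inner.1 hT
  simp only [ContinuousLinearMap.comp_apply]
  rw [← ContinuousLinearMap.adjoint_inner_left, hR]
  exact this _

theorem norm_inner_le_of_isPositive {T : H →L[ℂ] H} (hT : T.IsPositive) (v w : H) :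
    ‖⟪v, T w⟫_ℂ‖ ≤ √(⟪v, T v⟫_ℂ).re * √(⟪w, T w⟫_ℂ).re := by
  obtain ⟨R, hR, rfl⟩ := exists_sqrt hT
  have key : ∀ a c, ⟪a, (R ∘L R) c⟫_ℂ = ⟪R a, R c⟫_ℂ := fun a c => by
    rw [ContinuousLinearMap.comp_apply, ← ContinuousLinearMap.adjoint_inner_left, hR]
  have hs : ∀ a, √(⟪R a, R a⟫_ℂ).re = ‖R a‖ := fun a => by
    rw [← RCLike.re_eq_complex_re, inner_self_eq_norm_sq, Real.sqrt_sq (norm_nonneg _)]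
  simpa only [key, hs] using norm_inner_le_norm (R v) (R w)

namespace POVM

theorem apply_empty (M : POVM H) (v w : H) : ⟪v, M.toFun ∅ w⟫_ℂ = 0 := by
  have h := M.hasSum_iUnion (fun _ => ∅) (fun _ => MeasurableSet.empty)
    (fun _ _ _ => by simp [Function.onFun]) v w
  exact tendsto_nhds_unique tendsto_const_nhds h.summable.tendsto_atTop_zero

theorem sum_re_inner_le (M : POVM H) (f : ℕ → Set ℝ) (hf : ∀ i, MeasurableSet (f i))
    (hd : Pairwise (Function.onFun Disjoint f)) (v : H) (s : Finset ℕ) :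
    ∑ i ∈ s, (⟪v, M.toFun (f i) v⟫_ℂ).re ≤ ‖v‖ ^ 2 := by
  set g : ℕ → Set ℝ := fun n => Nat.casesOn n (⋃ i, f i)ᶜ f with hg
  have gm : ∀ i, MeasurableSet (g i) := by
    rintro (_ | i)
    · exact (MeasurableSet.iUnion hf).compl
    · exact hf i
  have gd : Pairwise (Function.onFun Disjoint g) := by
    rintro (_ | i) (_ | j) hij
    · exact absurd rfl hij
    · exact Set.disjoint_compl_left_iff_subset.2 (Set.subset_iUnion f j)
    · exact Set.disjoint_compl_right_iff_subset.2 (Set.subset_iUnion f i)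
    · exact hd (by simpa using hij)
  have gu : ⋃ i, g i = Set.univ := by
    refine Set.eq_univ_of_forall fun t => ?_
    by_cases ht : t ∈ ⋃ i, f i
    · obtain ⟨i, hi⟩ := Set.mem_iUnion.1 ht
      exact Set.mem_iUnion.2 ⟨i + 1, hi⟩
    · exact Set.mem_iUnion.2 ⟨0, ht⟩
  have h := Complex.hasSum_re (M.hasSum_iUnion g gm gd v v)
  rw [gu, M.univ, ContinuousLinearMap.id_apply, ← RCLike.re_eq_complex_re,
    inner_self_eq_norm_sq] at h
  have := sum_le_hasSum (s.map ⟨Nat.succ, Nat.succ_injective⟩) (fun i _ =>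
    (Complex.nonneg_iff.1 ((M.isPositive _ (gm i)).inner_nonneg_right v)).1) h
  simpa [hg] using this

theorem hasSum_trace (M : POVM H) (f : ℕ → Set ℝ) (hf : ∀ i, MeasurableSet (f i))
    (hd : Pairwise (Function.onFun Disjoint f)) {T : H →L[ℂ] H} (hT : IsTraceClass T) :
    HasSum (fun i => trace (M.toFun (f i) ∘L T)) (trace (M.toFun (⋃ i, f i) ∘L T)) := by
  obtain ⟨x, y, h⟩ := hT
  have htr : ∀ A : H →L[ℂ] H, trace (A ∘L T) = ∑' n, ⟪y n, A (x n)⟫_ℂ := fun A => by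
    have := (h.conj A (ContinuousLinearMap.id ℂ H)).trace_eq
    simpa [ContinuousLinearMap.adjoint_id] using this
  have bound : ∀ (n : ℕ) (s : Finset ℕ),
      ∑ i ∈ s, ‖⟪y n, M.toFun (f i) (x n)⟫_ℂ‖ ≤ ‖x n‖ * ‖y n‖ := by
    intro n s
    have nn : ∀ v i, 0 ≤ (⟪v, M.toFun (f i) v⟫_ℂ).re := fun v i =>
      (Complex.nonneg_iff.1 ((M.isPositive _ (hf i)).inner_nonneg_right v)).1
    calc ∑ i ∈ s, ‖⟪y n, M.toFun (f i) (x n)⟫_ℂ‖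
        ≤ ∑ i ∈ s, √(⟪y n, M.toFun (f i) (y n)⟫_ℂ).re * √(⟪x n, M.toFun (f i) (x n)⟫_ℂ).re :=
          Finset.sum_le_sum fun i _ => norm_inner_le_of_isPositive (M.isPositive _ (hf i)) _ _
      _ ≤ √(∑ i ∈ s, (⟪y n, M.toFun (f i) (y n)⟫_ℂ).re) *
            √(∑ i ∈ s, (⟪x n, M.toFun (f i) (x n)⟫_ℂ).re) :=
          Real.sum_sqrt_mul_sqrt_le _ (nn _) (nn _)
      _ ≤ √(‖y n‖ ^ 2) * √(‖x n‖ ^ 2) := by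
          gcongr <;> exact M.sum_re_inner_le f hf hd _ s
      _ = ‖x n‖ * ‖y n‖ := by
          rw [Real.sqrt_sq (norm_nonneg _), Real.sqrt_sq (norm_nonneg _), mul_comm]
  have key := hasSum_swap (fun n i => ⟪y n, M.toFun (f i) (x n)⟫_ℂ) h.1 bound
  simpa only [htr, (M.hasSum_iUnion f hf hd _ _).tsum_eq] using key

/-- The distribution of the outcome of the measurement `M` in the state `σ`:
the outcome lies in `B` with probability `tr (M(B) σ)`. -/
def outcomeLaw (M : POVM H) (σ : DensityOperator H) : MeasureTheory.Measure ℝ :=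
  MeasureTheory.Measure.ofMeasurable
    (fun B _ => ENNReal.ofReal (trace (M.toFun B ∘L σ.1.1)).re)
    (by
      have h : M.toFun ∅ = 0 := by
        ext w
        exact ext_inner_left ℂ fun v => by simpa using M.apply_empty v w
      simp [h, trace])
    (by
      intro f hf hd
      have h := Complex.hasSum_re (M.hasSum_trace f hf hd σ.1.2)
      rw [← h.tsum_eq, ENNReal.ofReal_tsum_of_nonneg (fun i => ?_) h.summable]
      exact (Complex.nonneg_iff.1
        (trace_mul_nonneg (M.isPositive _ (hf i)) σ.2.isPositive σ.1.2)).1)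

theorem outcomeLaw_apply (M : POVM H) (σ : DensityOperator H) {B : Set ℝ}
    (hB : MeasurableSet B) :
    M.outcomeLaw σ B = ENNReal.ofReal (trace (M.toFun B ∘L σ.1.1)).re :=
  MeasureTheory.Measure.ofMeasurable_apply B hB

instance (M : POVM H) (σ : DensityOperator H) :
    MeasureTheory.IsProbabilityMeasure (M.outcomeLaw σ) :=
  ⟨by simp [outcomeLaw_apply, M.univ, σ.2.trace_eq_one]⟩

end POVM

end Measurement

/-! ### Finite dimensional channels and their ampliations -/

section Channel

set_option linter.unusedSectionVars false

variable {a b : Type*} [Fintype a] [Fintype b]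

/-- Complete positivity of a linear map between matrix algebras. -/
def IsCompletelyPositive (Φ : Matrix a a ℂ →ₗ[ℂ] Matrix b b ℂ) : Prop :=
  ∀ (m : ℕ) (X : Matrix (Fin m × a) (Fin m × a) ℂ), X.PosSemidef →
    (Matrix.of fun p q : Fin m × b =>
      Φ (Matrix.of fun i j => X (p.1, i) (q.1, j)) p.2 q.2).PosSemidef

/-- A channel with input space `ℂ^a` and output space `ℂ^b`. -/
structure MatrixChannel (a b : Type*) [Fintype a] [Fintype b] where
  toLinearMap : Matrix a a ℂ →ₗ[ℂ] Matrix b b ℂ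
  completelyPositive : IsCompletelyPositive toLinearMap
  trace_preserving : ∀ X, (toLinearMap X).trace = X.trace

/-- The Hilbert space `ℂ^a ⊗ K`, realised as the Hilbert direct sum of copies of `K` indexed
by `a`. -/
abbrev Joint (a K : Type*) : Type _ := PiLp 2 fun _ : a => K

variable {K : Type*} [NormedAddCommGroup K] [InnerProductSpace ℂ K] [CompleteSpace K]
  [DecidableEq a] [DecidableEq b]

/-- The isometry `ψ ↦ e i ⊗ ψ`. -/
def inj (K : Type*) [NormedAddCommGroup K] [InnerProductSpace ℂ K] (i : a) :
    K →L[ℂ] Joint a K :=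
  (PiLp.continuousLinearEquiv 2 ℂ fun _ : a => K).symm.toContinuousLinearMap ∘L
    ContinuousLinearMap.single ℂ (fun _ : a => K) i

/-- The block `X i j` of an operator `X` on `ℂ^a ⊗ K`, so that `X = ∑ i j, |e i⟩⟨e j| ⊗ X i j`. -/
def block (i j : a) : traceClass (Joint a K) →ₗ[ℂ] traceClass K where
  toFun X := ⟨PiLp.proj 2 (fun _ : a => K) i ∘L X.1 ∘L inj K j, X.2.conj _ _⟩
  map_add' X Y := by ext; simp
  map_smul' c X := by ext; simp

/-- The operator `|e i⟩⟨e j| ⊗ T` on `ℂ^a ⊗ K`. -/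
def unblock (i j : a) : traceClass K →ₗ[ℂ] traceClass (Joint a K) where
  toFun T := ⟨inj K i ∘L T.1 ∘L PiLp.proj 2 (fun _ : a => K) j, T.2.conj _ _⟩
  map_add' X Y := by ext; simp
  map_smul' c X := by ext; simp

/-- The ampliation `Φ ⊗ id`, which maps `∑ i j, |e i⟩⟨e j| ⊗ X i j` to
`∑ i j, Φ(|e i⟩⟨e j|) ⊗ X i j`. -/
def ampliation (K : Type*) [NormedAddCommGroup K] [InnerProductSpace ℂ K] [CompleteSpace K]
    (Φ : Matrix a a ℂ →ₗ[ℂ] Matrix b b ℂ) :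
    traceClass (Joint a K) →ₗ[ℂ] traceClass (Joint b K) :=
  ∑ k : b, ∑ l : b, unblock (K := K) k l ∘ₗ
    ∑ i : a, ∑ j : a, Φ (Matrix.single i j 1) k l • block (K := K) i j

theorem ampliation_apply (Φ : Matrix a a ℂ →ₗ[ℂ] Matrix b b ℂ) (X : traceClass (Joint a K)) :
    ampliation K Φ X =
      ∑ k, ∑ l, unblock k l (∑ i, ∑ j, Φ (Matrix.single i j 1) k l • block i j X) := by
  simp [ampliation, LinearMap.sum_apply]

theorem inner_inj_right (i : a) (v : Joint a K) (w : K) : ⟪v, inj K i w⟫_ℂ = ⟪v i, w⟫_ℂ := by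
  simp only [PiLp.inner_apply, inj]
  rw [Finset.sum_eq_single i] <;> simp +contextual

theorem inner_inj_left (i : a) (v : Joint a K) (w : K) : ⟪inj K i w, v⟫_ℂ = ⟪w, v i⟫_ℂ := by
  rw [← inner_conj_symm, inner_inj_right, inner_conj_symm]

theorem inner_unblock (k l : b) (T : traceClass K) (v : Joint b K) :
    ⟪v, (unblock k l T).1 v⟫_ℂ = ⟪v k, T.1 (v l)⟫_ℂ := by
  simp [unblock, inner_inj_right]

theorem inner_block (i j : a) (X : traceClass (Joint a K)) (v w : K) :
    ⟪v, (block i j X).1 w⟫_ℂ = ⟪inj K i v, X.1 (inj K j w)⟫_ℂ := by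
  simp [block, inner_inj_left]

theorem posSemidef_of_isPositive {ι H : Type*} [Fintype ι] [NormedAddCommGroup H]
    [InnerProductSpace ℂ H] {T : H →L[ℂ] H} (hT : T.IsPositive) (u : ι → H) :
    (Matrix.of fun p q => ⟪u p, T (u q)⟫_ℂ).PosSemidef := by
  refine Matrix.PosSemidef.of_dotProduct_mulVec_nonneg ?_ fun x => ?_
  · ext p q
    simp only [Matrix.conjTranspose_apply, Matrix.of_apply, RCLike.star_def, inner_conj_symm]
    exact hT.inner_left_eq_inner_right _ _
  · convert hT.inner_nonneg_right (∑ p, x p • u p) using 1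
    simp only [dotProduct, Matrix.mulVec, Matrix.of_apply, map_sum, map_smul, sum_inner,
      inner_sum, inner_smul_left, inner_smul_right, Pi.star_apply, RCLike.star_def,
      Finset.mul_sum]
    rw [Finset.sum_comm]
    refine Finset.sum_congr rfl fun p _ => Finset.sum_congr rfl fun q _ => ?_
    ring

theorem apply_eq_sum_single (Φ : Matrix a a ℂ →ₗ[ℂ] Matrix b b ℂ) (Y : Matrix a a ℂ) (k l : b) :
    Φ Y k l = ∑ i, ∑ j, Φ (Matrix.single i j 1) k l * Y i j := by
  conv_lhs => rw [Matrix.matrix_eq_sum_single Y]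
  simp only [map_sum, Matrix.sum_apply]
  refine Finset.sum_congr rfl fun i _ => Finset.sum_congr rfl fun j _ => ?_
  rw [show Matrix.single i j (Y i j) = Y i j • Matrix.single i j (1 : ℂ) by simp]
  rw [map_smul, Matrix.smul_apply, smul_eq_mul, mul_comm]

theorem inner_ampliation (Φ : Matrix a a ℂ →ₗ[ℂ] Matrix b b ℂ) (X : traceClass (Joint a K))
    (v : Joint b K) :
    ⟪v, (ampliation K Φ X).1 v⟫_ℂ = ∑ k, ∑ l,
      Φ (Matrix.of fun i j => ⟪inj K i (v k), X.1 (inj K j (v l))⟫_ℂ) k l := by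
  rw [ampliation_apply]
  simp only [Submodule.coe_sum, sum_apply, inner_sum, inner_unblock,
    Submodule.coe_smul, smul_apply, inner_smul_right, inner_block]
  refine Finset.sum_congr rfl fun k _ => Finset.sum_congr rfl fun l _ => ?_
  rw [apply_eq_sum_single]
  rfl

theorem ampliation_isPositive {Φ : Matrix a a ℂ →ₗ[ℂ] Matrix b b ℂ}
    (hΦ : IsCompletelyPositive Φ) {X : traceClass (Joint a K)} (hX : X.1.IsPositive) :
    (ampliation K Φ X).1.IsPositive := by
  refine isPositive_iff_inner.2 fun v => ?_
  rw [inner_ampliation]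
  let e := Fintype.equivFin b
  have h := hΦ (Fintype.card b) _ (posSemidef_of_isPositive hX
    fun p : Fin (Fintype.card b) × a => inj K p.2 (v (e.symm p.1)))
  have h2 := (h.submatrix fun k : b => (e k, k)).dotProduct_mulVec_nonneg fun _ => 1
  simpa [dotProduct, Matrix.mulVec] using h2

theorem trace_ampliation {Φ : Matrix a a ℂ →ₗ[ℂ] Matrix b b ℂ}
    (hΦ : ∀ Y, (Φ Y).trace = Y.trace) (X : traceClass (Joint a K)) :
    trace (ampliation K Φ X).1 = trace X.1 := by
  have h1 : ∀ (k l : b) (T : traceClass K),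
      traceₗ _ (unblock k l T) = if k = l then traceₗ K T else 0 := by
    intro k l T
    have : traceₗ _ (unblock k l T) =
        trace (PiLp.proj 2 (fun _ : b => K) l ∘L inj K k ∘L T.1) := trace_conj T.2 _ _
    rw [this]
    split_ifs with hkl
    · subst hkl
      congr 1
      ext v
      simp [inj]
    · have : PiLp.proj 2 (fun _ : b => K) l ∘L inj K k ∘L T.1 = 0 := by
        ext v
        simp [inj, Ne.symm hkl]
      simp [this, trace]
  have h2 : ∑ i, traceₗ K (block i i X) = traceₗ _ X := by
    have e1 : ∀ i, traceₗ K (block i i X) =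
        trace (inj K i ∘L PiLp.proj 2 (fun _ : a => K) i ∘L X.1) := fun i =>
      trace_conj X.2 (PiLp.proj 2 (fun _ : a => K) i) (inj K i)
    have m : ∀ i, IsTraceClass (inj K i ∘L PiLp.proj 2 (fun _ : a => K) i ∘L X.1) := fun i => by
      exact X.2.conj (inj K i ∘L PiLp.proj 2 (fun _ : a => K) i) (ContinuousLinearMap.id ℂ _)
    have e2 : ∑ i, (⟨_, m i⟩ : traceClass (Joint a K)) = X := by
      ext v j
      simp only [Submodule.coe_sum, sum_apply]
      simp [inj, Finset.sum_apply, Pi.single_apply]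
    rw [← e2, map_sum]
    rw [e2]
    exact Finset.sum_congr rfl fun i _ => e1 i
  change traceₗ _ (ampliation K Φ X) = traceₗ _ X
  rw [ampliation_apply]
  have h3 : ∀ i j, ∑ k, Φ (Matrix.single i j 1) k k = if i = j then 1 else 0 := fun i j => by
    have := hΦ (Matrix.single i j 1)
    split_ifs with hij
    · subst hij
      simpa [Matrix.trace] using this
    · rw [Matrix.trace_single_eq_of_ne _ _ _ hij] at this
      simpa [Matrix.trace] using this
  have h4 : ∀ k, ∑ l, traceₗ (Joint b K)
      (unblock k l (∑ i, ∑ j, Φ (Matrix.single i j 1) k l • block i j X)) =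
        ∑ i, ∑ j, Φ (Matrix.single i j 1) k k * traceₗ K (block i j X) := fun k => by
    simp only [h1]
    rw [Finset.sum_ite_eq, if_pos (Finset.mem_univ k)]
    simp only [map_sum, map_smul, smul_eq_mul]
  simp only [map_sum (traceₗ (Joint b K)), h4]
  rw [← h2, Finset.sum_comm]
  refine Finset.sum_congr rfl fun i _ => ?_
  rw [Finset.sum_comm]
  simp only [← Finset.sum_mul, h3]
  simp

/-- The action of `Φ ⊗ id` on the states of `ℂ^a ⊗ K`. -/
def MatrixChannel.applyJoint (Φ : MatrixChannel a b) (σ : DensityOperator (Joint a K)) :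
    DensityOperator (Joint b K) :=
  ⟨ampliation K Φ.toLinearMap σ.1, ampliation_isPositive Φ.completelyPositive σ.2.isPositive,
    (trace_ampliation Φ.trace_preserving _).trans σ.2.trace_eq_one⟩

end Channel

/-! ### Adaptive estimators -/

section Estimator

variable {a b K : Type*} [Fintype a] [Fintype b] [DecidableEq a] [DecidableEq b]
  [NormedAddCommGroup K] [InnerProductSpace ℂ K] [CompleteSpace K]

/-- An adaptive estimation scheme which uses an unknown channel (from `ℂ^a` to `ℂ^b`)
`n + 1` times, with ancilla space `K`: an input state, a channel `first` applied before the first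
use, channels `next k` applied between the uses, and a real valued measurement of the final
state. -/
structure AdaptiveScheme (a b K : Type*) [Fintype a] [Fintype b]
    [NormedAddCommGroup K] [InnerProductSpace ℂ K] [CompleteSpace K] (n : ℕ) where
  input : DensityOperator (Joint a K)
  first : QuantumChannel (Joint a K) (Joint a K)
  next : Fin n → QuantumChannel (Joint b K) (Joint a K)
  measurement : POVM (Joint b K)

/-- Alternately apply the channels `Ψ 0, Ψ 1, …` and the ampliation of `Φ` to `σ`. -/
def alternate (Φ : MatrixChannel a b) :
    (n : ℕ) → (Fin n → QuantumChannel (Joint b K) (Joint a K)) →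
      DensityOperator (Joint b K) → DensityOperator (Joint b K)
  | 0, _, σ => σ
  | n + 1, Ψ, σ =>
    Φ.applyJoint ((Ψ (Fin.last n)).apply (alternate Φ n (fun k => Ψ k.castSucc) σ))

namespace AdaptiveScheme

variable {n : ℕ}

/-- The final state, when the unknown channel is `Φ`. -/
def output (S : AdaptiveScheme a b K n) (Φ : MatrixChannel a b) : DensityOperator (Joint b K) :=
  alternate Φ n S.next (Φ.applyJoint (S.first.apply S.input))

/-- The distribution of the estimate, when the unknown channel is `Φ`. -/
def law (S : AdaptiveScheme a b K n) (Φ : MatrixChannel a b) : MeasureTheory.Measure ℝ :=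
  S.measurement.outcomeLaw (S.output Φ)

/-- The expectation of the estimate, when the unknown channel is `Φ`. -/
def mean (S : AdaptiveScheme a b K n) (Φ : MatrixChannel a b) : ℝ := ∫ x, x ∂(S.law Φ)

/-- The mean square error of the estimate as an estimate of `θ`, when the unknown channel is `Φ`;
it may be infinite. -/
def mse (S : AdaptiveScheme a b K n) (Φ : MatrixChannel a b) (θ : ℝ) : ℝ≥0∞ :=
  ∫⁻ x, ENNReal.ofReal ((x - θ) ^ 2) ∂(S.law Φ)

end AdaptiveScheme

/-- `Δ` is the derivative at `θ` of the family `Φ`. -/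
def HasChannelDerivAt (Φ : ℝ → MatrixChannel a b) (Δ : Matrix a a ℂ →ₗ[ℂ] Matrix b b ℂ)
    (θ : ℝ) : Prop :=
  ∀ (X : Matrix a a ℂ) (k l : b),
    HasDerivAt (fun t => (Φ t).toLinearMap X k l) (Δ X k l) θ

/-- Asymptotic unbiasedness at the parameter value `θ`: the expectation of the estimate (which
exists for the parameter values near `θ`) tends to `θ`, and its derivative tends to `1`. -/
structure AsymptoticallyUnbiasedAt {K : ℕ → Type*} [∀ n, NormedAddCommGroup (K n)]
    [∀ n, InnerProductSpace ℂ (K n)] [∀ n, CompleteSpace (K n)]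
    (S : (n : ℕ) → AdaptiveScheme a b (K n) n) (Φ : ℝ → MatrixChannel a b) (θ : ℝ) : Prop where
  integrable : ∀ᶠ n in Filter.atTop, ∀ᶠ t in 𝓝 θ,
    MeasureTheory.Integrable (fun x : ℝ => x) ((S n).law (Φ t))
  tendsto_mean : Filter.Tendsto (fun n => (S n).mean (Φ θ)) Filter.atTop (𝓝 θ)
  tendsto_deriv : ∃ d : ℕ → ℝ,
    (∀ᶠ n in Filter.atTop, HasDerivAt (fun t => (S n).mean (Φ t)) (d n) θ) ∧
      Filter.Tendsto d Filter.atTop (𝓝 1)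

end Estimator

end ChannelEstimation

end

/-!
The bound is a Cramér–Rao inequality obtained by classical simulation of the channel.

Since `Φ` preserves the trace, its derivative `Δ` maps into trace zero matrices, so `Φ ± εΔ` are
channels. To first order at `θ`, `Φ (θ + s)` is the mixture of these two channels with weights
`(1 ± s / ε) / 2`, a binary random variable of score `± 1 / ε` and Fisher information `1 / ε²`.
After `n` uses, whatever is done in between, the state at `θ` is therefore a mixture
`∑ i, p i • τ i` of states, and its derivative is `∑ i, p i * ℓ i • τ i`, with scores `ℓ` such that
`∑ i, p i * ℓ i ^ 2 = n / ε²`. This is `HasScoreDecomposition`; it is preserved by known channels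
(`HasScoreDecomposition.apply`) and gains `1 / ε²` with each use of the unknown one
(`HasScoreDecomposition.applyJoint`). If `d` is the derivative of the mean of the estimate, then
`d = ∑ i, p i * ℓ i * (m i - θ)`, where `m i` is the mean in the state `τ i`, and the
Cauchy–Schwarz inequality gives `d ^ 2 ≤ (n / ε²) * mse` (`HasScoreDecomposition.sq_deriv_le`).

The estimate is unbounded, so it must be justified that the mean can be differentiated under the
integral. Here one uses that the input and output spaces are finite dimensional: the state depends
on the parameter through finitely many matrix entries of the channel, and hence moves in a finite
dimensional space of trace class operators. It is thus differentiable against *every* linear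
functional, without any continuity assumption (`HasAlgebraicDerivAt`). The mean is the limit of
the integrals of simple functions, which are linear functionals on the trace class. The limit is a
linear functional on the subspace on which it exists; this subspace contains the states with
parameter near `θ`, hence also the derivative, because a functional that vanishes on the subspace
vanishes at the derivative (`HasAlgebraicDerivAt.tendsto_of_hasDerivAt`).
-/

noncomputable section

namespace ChannelEstimation

/-! ### Differentiation against all linear functionals -/

section AlgebraicDeriv

variable {E F : Type*} [AddCommGroup E] [Module ℂ E] [AddCommGroup F] [Module ℂ F]

/-- `D` is the derivative at `θ` of the curve `σ` in a vector space without topology: every linear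
functional of `σ` is differentiable, with the expected derivative. -/
def HasAlgebraicDerivAt (σ : ℝ → E) (D : E) (θ : ℝ) : Prop :=
  ∀ g : E →ₗ[ℂ] ℂ, HasDerivAt (fun t => g (σ t)) (g D) θ

theorem HasAlgebraicDerivAt.map {σ : ℝ → E} {D : E} {θ : ℝ} (h : HasAlgebraicDerivAt σ D θ)
    (A : E →ₗ[ℂ] F) : HasAlgebraicDerivAt (fun t => A (σ t)) (A D) θ :=
  fun g => h (g ∘ₗ A)

/-- The subspace on which a sequence of linear functionals converges. -/
def convergenceSubmodule (L : ℕ → E →ₗ[ℂ] ℂ) : Submodule ℂ E where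
  carrier := {v | ∃ c, Filter.Tendsto (fun n => L n v) Filter.atTop (𝓝 c)}
  zero_mem' := ⟨0, by simp⟩
  add_mem' := by
    rintro v w ⟨c, hc⟩ ⟨c', hc'⟩
    exact ⟨c + c', by simpa using hc.add hc'⟩
  smul_mem' := by
    rintro z v ⟨c, hc⟩
    exact ⟨z * c, by simpa using hc.const_mul z⟩

/-- The pointwise limit of a sequence of linear functionals, where it exists. -/
def limitFunctional (L : ℕ → E →ₗ[ℂ] ℂ) : convergenceSubmodule L →ₗ[ℂ] ℂ where
  toFun v := v.2.choose
  map_add' v w := tendsto_nhds_unique (v + w).2.choose_spec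
    (by simpa using v.2.choose_spec.add w.2.choose_spec)
  map_smul' z v := tendsto_nhds_unique (z • v).2.choose_spec
    (by simpa using v.2.choose_spec.const_mul z)

theorem limitFunctional_eq {L : ℕ → E →ₗ[ℂ] ℂ} (v : convergenceSubmodule L) {c : ℂ}
    (h : Filter.Tendsto (fun n => L n v) Filter.atTop (𝓝 c)) : limitFunctional L v = c :=
  tendsto_nhds_unique v.2.choose_spec h

/-- The derivative of a pointwise limit of linear functionals along `σ` is the limit of their
values at the derivative of `σ`. No uniformity is needed: the limit, extended from
the subspace where it exists, is one of the functionals in `HasAlgebraicDerivAt`. -/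
theorem HasAlgebraicDerivAt.tendsto_of_hasDerivAt {σ : ℝ → E} {D : E} {θ : ℝ}
    (h : HasAlgebraicDerivAt σ D θ) (L : ℕ → E →ₗ[ℂ] ℂ) {m : ℝ → ℂ} {d : ℂ}
    (hL : ∀ᶠ t in 𝓝 θ, Filter.Tendsto (fun n => L n (σ t)) Filter.atTop (𝓝 (m t)))
    (hm : HasDerivAt m d θ) : Filter.Tendsto (fun n => L n D) Filter.atTop (𝓝 d) := by
  have hD : D ∈ convergenceSubmodule L := by
    by_contra hD
    obtain ⟨g, hg, hker⟩ := Submodule.exists_le_ker_of_notMem hD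
    refine hg ((h g).unique ((hasDerivAt_const θ (0 : ℂ)).congr_of_eventuallyEq ?_))
    filter_upwards [hL] with t ht
    exact hker ⟨m t, ht⟩
  obtain ⟨g, hg⟩ := LinearMap.exists_extend (limitFunctional L)
  have hgV : ∀ v (hv : v ∈ convergenceSubmodule L), g v = limitFunctional L ⟨v, hv⟩ :=
    fun v hv => LinearMap.congr_fun hg ⟨v, hv⟩
  have hd : g D = d := by
    refine (h g).unique (hm.congr_of_eventuallyEq ?_)
    filter_upwards [hL] with t ht
    rw [hgV _ ⟨m t, ht⟩]
    exact limitFunctional_eq ⟨σ t, m t, ht⟩ ht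
  rw [← hd, hgV D hD]
  exact hD.choose_spec

end AlgebraicDeriv

/-! ### The law of the outcome as a function of the state -/

section Law

variable {H : Type*} [NormedAddCommGroup H] [InnerProductSpace ℂ H] [CompleteSpace H]

/-- The linear functional `T ↦ tr (A T)` on the trace class. -/
def traceMul (A : H →L[ℂ] H) : traceClass H →ₗ[ℂ] ℂ :=
  traceₗ H ∘ₗ
    { toFun := fun T => ⟨A ∘L T.1, T.2.conj A (ContinuousLinearMap.id ℂ H)⟩
      map_add' := fun S T => by ext; simp
      map_smul' := fun c T => by ext; simp }

theorem traceMul_apply (A : H →L[ℂ] H) (T : traceClass H) : traceMul A T = trace (A ∘L T.1) := rfl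

namespace POVM

theorem traceMul_eq_real (M : POVM H) (σ : DensityOperator H) {B : Set ℝ}
    (hB : MeasurableSet B) : traceMul (M.toFun B) σ.1 = ((M.outcomeLaw σ).real B : ℂ) := by
  have h := Complex.nonneg_iff.1 (trace_mul_nonneg (M.isPositive _ hB) σ.2.isPositive σ.1.2)
  rw [traceMul_apply, MeasureTheory.measureReal_def, M.outcomeLaw_apply σ hB,
    ENNReal.toReal_ofReal h.1]
  exact Complex.ext rfl (by simpa using h.2.symm)

/-- The linear functional on the trace class which maps a state to the integral of the simple
function `f` with respect to the law of the outcome. -/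
def simpleIntegral (M : POVM H) (f : MeasureTheory.SimpleFunc ℝ ℝ) : traceClass H →ₗ[ℂ] ℂ :=
  ∑ y ∈ f.range, (y : ℂ) • traceMul (M.toFun (f ⁻¹' {y}))

theorem simpleIntegral_eq_integral (M : POVM H) (f : MeasureTheory.SimpleFunc ℝ ℝ)
    (σ : DensityOperator H) :
    M.simpleIntegral f σ.1 = ((f.integral (M.outcomeLaw σ) : ℝ) : ℂ) := by
  rw [f.integral_eq_integral (f.integrable_of_isFiniteMeasure),
    f.integral_eq_sum (f.integrable_of_isFiniteMeasure)]
  simp only [simpleIntegral, LinearMap.sum_apply, LinearMap.smul_apply, Complex.ofReal_sum]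
  refine Finset.sum_congr rfl fun y _ => ?_
  rw [M.traceMul_eq_real σ (f.measurableSet_fiber y)]
  simp [mul_comm]

/-- Functionals on the trace class which approximate the mean of the outcome. -/
def approxMean (M : POVM H) (n : ℕ) : traceClass H →ₗ[ℂ] ℂ :=
  M.simpleIntegral (MeasureTheory.SimpleFunc.approxOn (fun x : ℝ => x) measurable_id Set.univ 0
    (Set.mem_univ 0) n)

theorem tendsto_approxMean (M : POVM H) (σ : DensityOperator H)
    (h : MeasureTheory.Integrable (fun x : ℝ => x) (M.outcomeLaw σ)) :
    Filter.Tendsto (fun n => M.approxMean n σ.1) Filter.atTop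
      (𝓝 ((∫ x, x ∂(M.outcomeLaw σ) : ℝ) : ℂ)) := by
  simp only [approxMean, simpleIntegral_eq_integral]
  exact (Complex.continuous_ofReal.tendsto _).comp
    (MeasureTheory.tendsto_integral_approxOn_of_measurable h measurable_id (by simp)
      (Set.mem_univ 0) (MeasureTheory.integrable_const 0))

theorem outcomeLaw_mixture (M : POVM H) {ι : Type*} [Fintype ι] (p : ι → ℝ) (hp : ∀ i, 0 ≤ p i)
    (τ : ι → DensityOperator H) (σ : DensityOperator H)
    (h : σ.1 = ∑ i, (p i : ℂ) • (τ i).1) :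
    M.outcomeLaw σ = ∑ i, ENNReal.ofReal (p i) • M.outcomeLaw (τ i) := by
  ext B hB
  have key : (M.outcomeLaw σ).real B = ∑ i, p i * (M.outcomeLaw (τ i)).real B := by
    have := M.traceMul_eq_real σ hB
    rw [h, map_sum] at this
    simp only [map_smul, M.traceMul_eq_real _ hB, smul_eq_mul] at this
    exact_mod_cast this.symm
  rw [← MeasureTheory.ofReal_measureReal, key,
    ENNReal.ofReal_sum_of_nonneg fun i _ => mul_nonneg (hp i) MeasureTheory.measureReal_nonneg]
  simp [MeasureTheory.Measure.finsetSum_apply, ENNReal.ofReal_mul (hp _)]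

end POVM

end Law

/-! ### First and second moments of a real law -/

section Moments

open MeasureTheory

theorem memLp_sub_of_lintegral_ne_top {μ : Measure ℝ} {θ : ℝ}
    (h : ∫⁻ x, ENNReal.ofReal ((x - θ) ^ 2) ∂μ ≠ ∞) : MemLp (fun x : ℝ => x - θ) 2 μ := by
  rw [memLp_two_iff_integrable_sq (by fun_prop)]
  refine ⟨by fun_prop, ?_⟩
  rw [hasFiniteIntegral_iff_ofReal (Filter.Eventually.of_forall fun x => sq_nonneg _)]
  exact h.lt_top

theorem integrable_of_lintegral_sq_ne_top {μ : Measure ℝ} [IsProbabilityMeasure μ] {θ : ℝ}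
    (h : ∫⁻ x, ENNReal.ofReal ((x - θ) ^ 2) ∂μ ≠ ∞) : Integrable (fun x : ℝ => x) μ := by
  refine (((memLp_sub_of_lintegral_ne_top h).integrable one_le_two).add
    (integrable_const θ)).congr (Filter.Eventually.of_forall fun x => ?_)
  simp

theorem sq_integral_sub_le {μ : Measure ℝ} [IsProbabilityMeasure μ] {θ : ℝ}
    (h : ∫⁻ x, ENNReal.ofReal ((x - θ) ^ 2) ∂μ ≠ ∞) :
    ((∫ x, x ∂μ) - θ) ^ 2 ≤ (∫⁻ x, ENNReal.ofReal ((x - θ) ^ 2) ∂μ).toReal := by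
  have hL := memLp_sub_of_lintegral_ne_top h
  have hv := ProbabilityTheory.variance_nonneg (fun x : ℝ => x - θ) μ
  rw [ProbabilityTheory.variance_eq_sub hL, sub_nonneg,
    integral_sub (integrable_of_lintegral_sq_ne_top h) (integrable_const θ)] at hv
  rw [← integral_eq_lintegral_of_nonneg_ae (Filter.Eventually.of_forall fun x => sq_nonneg _)
    (by fun_prop)]
  simpa using hv

end Moments

/-! ### Score decompositions -/

section Score

variable {H H₁ H₂ : Type*}
  [NormedAddCommGroup H] [InnerProductSpace ℂ H] [CompleteSpace H]
  [NormedAddCommGroup H₁] [InnerProductSpace ℂ H₁] [CompleteSpace H₁]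
  [NormedAddCommGroup H₂] [InnerProductSpace ℂ H₂] [CompleteSpace H₂]

/-- To first order at `θ`, the family of states `σ` is a mixture of fixed states `τ i` with
weights `p i * (1 + (t - θ) * ℓ i)`, a classical model with scores `ℓ i` of mean zero and with
Fisher information `v`. The weights `p i` are strictly positive, so that moments which are finite
for `σ θ` are finite for every `τ i`. -/
def HasScoreDecomposition (σ : ℝ → DensityOperator H) (θ v : ℝ) : Prop :=
  ∃ (ι : Type) (_ : Fintype ι) (p ℓ : ι → ℝ) (τ : ι → DensityOperator H),
    (∀ i, 0 < p i) ∧ ∑ i, p i * ℓ i = 0 ∧ ∑ i, p i = 1 ∧ ∑ i, p i * ℓ i ^ 2 = v ∧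
    (σ θ).1 = ∑ i, (p i : ℂ) • (τ i).1 ∧
    HasAlgebraicDerivAt (fun t => (σ t).1) (∑ i, ((p i * ℓ i : ℝ) : ℂ) • (τ i).1) θ

theorem hasScoreDecomposition_const (σ : DensityOperator H) (θ : ℝ) :
    HasScoreDecomposition (fun _ => σ) θ 0 := by
  refine ⟨Unit, inferInstance, fun _ => 1, fun _ => 0, fun _ => σ, by simp, by simp, by simp,
    by simp, by simp, fun g => ?_⟩
  simpa using hasDerivAt_const θ (g σ.1)

theorem HasScoreDecomposition.apply {σ : ℝ → DensityOperator H₁} {θ v : ℝ}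
    (h : HasScoreDecomposition σ θ v) (Ψ : QuantumChannel H₁ H₂) :
    HasScoreDecomposition (fun t => Ψ.apply (σ t)) θ v := by
  obtain ⟨ι, _, p, ℓ, τ, hp, h0, h1, hv, hσ, hD⟩ := h
  refine ⟨ι, inferInstance, p, ℓ, fun i => Ψ.apply (τ i), hp, h0, h1, hv, ?_, ?_⟩
  · simp [QuantumChannel.apply, hσ]
  · simpa [QuantumChannel.apply] using hD.map Ψ.toLinearMap

/-- The quantum Cramér–Rao inequality for a score decomposition and an estimator whose mean has
derivative `d`. The mean square error may be infinite; `0 < v` excludes the product `0 * ∞`. -/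
theorem HasScoreDecomposition.sq_deriv_le {σ : ℝ → DensityOperator H} {θ v : ℝ}
    (h : HasScoreDecomposition σ θ v) (hv0 : 0 < v) (M : POVM H)
    (hint : ∀ᶠ t in 𝓝 θ, MeasureTheory.Integrable (fun x : ℝ => x) (M.outcomeLaw (σ t)))
    {d : ℝ} (hd : HasDerivAt (fun t => ∫ x, x ∂(M.outcomeLaw (σ t))) d θ) :
    ENNReal.ofReal (d ^ 2) ≤
      ENNReal.ofReal v * ∫⁻ x, ENNReal.ofReal ((x - θ) ^ 2) ∂(M.outcomeLaw (σ θ)) := by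
  obtain ⟨ι, _, p, ℓ, τ, hp, h0, h1, hv, hσ, hD⟩ := h
  set e : ι → ℝ≥0∞ := fun i => ∫⁻ x, ENNReal.ofReal ((x - θ) ^ 2) ∂(M.outcomeLaw (τ i)) with he
  have hmse : ∫⁻ x, ENNReal.ofReal ((x - θ) ^ 2) ∂(M.outcomeLaw (σ θ)) =
      ∑ i, ENNReal.ofReal (p i) * e i := by
    rw [M.outcomeLaw_mixture p (fun i => (hp i).le) τ _ hσ,
      MeasureTheory.lintegral_finsetSum_measure]
    simp [he]
  rw [hmse]
  by_cases hfin : ∀ i, e i ≠ ∞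
  · have hlim := hD.tendsto_of_hasDerivAt M.approxMean (m := fun t =>
      ((∫ x, x ∂(M.outcomeLaw (σ t)) : ℝ) : ℂ)) (d := (d : ℂ))
      (by filter_upwards [hint] with t ht using M.tendsto_approxMean _ ht) hd.ofReal_comp
    have hlim' : Filter.Tendsto
        (fun n => M.approxMean n (∑ i, ((p i * ℓ i : ℝ) : ℂ) • (τ i).1)) Filter.atTop
        (𝓝 (∑ i, ((p i * ℓ i : ℝ) : ℂ) * ((∫ x, x ∂(M.outcomeLaw (τ i)) : ℝ) : ℂ))) := by
      simp only [map_sum, map_smul, smul_eq_mul]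
      exact tendsto_finsetSum _ fun i _ => (M.tendsto_approxMean (τ i)
        (integrable_of_lintegral_sq_ne_top (hfin i))).const_mul _
    have hdm : d = ∑ i, p i * ℓ i * ∫ x, x ∂(M.outcomeLaw (τ i)) := by
      exact_mod_cast tendsto_nhds_unique hlim hlim'
    -- The scores have mean zero, so the estimate may be centred at `θ`.
    have hdm' : d = ∑ i, p i * ℓ i * ((∫ x, x ∂(M.outcomeLaw (τ i))) - θ) := by
      simp only [mul_sub, Finset.sum_sub_distrib, ← Finset.sum_mul, h0, ← hdm]
      simp
    have hsum : ∑ i, ENNReal.ofReal (p i) * e i = ENNReal.ofReal (∑ i, p i * (e i).toReal) := by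
      rw [ENNReal.ofReal_sum_of_nonneg fun i _ => mul_nonneg (hp i).le ENNReal.toReal_nonneg]
      exact Finset.sum_congr rfl fun i _ => by
        rw [ENNReal.ofReal_mul (hp i).le, ENNReal.ofReal_toReal (hfin i)]
    rw [hsum, ← ENNReal.ofReal_mul
      hv0.le, ← hv, hdm']
    refine ENNReal.ofReal_le_ofReal (Finset.sum_sq_le_sum_mul_sum_of_sq_le_mul _
      (fun i _ => mul_nonneg (hp i).le (sq_nonneg _))
      (fun i _ => mul_nonneg (hp i).le ENNReal.toReal_nonneg) fun i _ => ?_)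
    have hm := sq_integral_sub_le (hfin i)
    calc (p i * ℓ i * ((∫ x, x ∂(M.outcomeLaw (τ i))) - θ)) ^ 2
        = p i * ℓ i ^ 2 * (p i * ((∫ x, x ∂(M.outcomeLaw (τ i))) - θ) ^ 2) := by ring
      _ ≤ p i * ℓ i ^ 2 * (p i * (e i).toReal) := by
          have := (hp i).le
          gcongr
  -- One infinite error among the `τ i` makes the right hand side infinite.
  · push Not at hfin
    obtain ⟨i, hi⟩ := hfin
    have htop : ∑ i, ENNReal.ofReal (p i) * e i = ∞ := by
      refine ENNReal.sum_eq_top.2 ⟨i, Finset.mem_univ i, ?_⟩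
      rw [hi, ENNReal.mul_top (by simpa using hp i)]
    rw [htop, ENNReal.mul_top (by simpa using hv0)]
    exact le_top

end Score

/-! ### Differentiable families of channels -/

section Channel

variable {a b : Type*} [Fintype a] [Fintype b]

theorem HasChannelDerivAt.trace_eq_zero {Φ : ℝ → MatrixChannel a b}
    {Δ : Matrix a a ℂ →ₗ[ℂ] Matrix b b ℂ} {θ : ℝ} (hΔ : HasChannelDerivAt Φ Δ θ)
    (X : Matrix a a ℂ) : (Δ X).trace = 0 := by
  have h : HasDerivAt (fun t => ((Φ t).toLinearMap X).trace) (Δ X).trace θ :=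
    HasDerivAt.fun_sum fun k _ => hΔ X k k
  simp only [(Φ _).trace_preserving] at h
  exact h.unique (hasDerivAt_const θ _)

/-- The channel `Φ + c Δ`. -/
def MatrixChannel.perturb (Φ : MatrixChannel a b) (Δ : Matrix a a ℂ →ₗ[ℂ] Matrix b b ℂ)
    (c : ℂ) (hΔ : ∀ X, (Δ X).trace = 0) (h : IsCompletelyPositive (Φ.toLinearMap + c • Δ)) :
    MatrixChannel a b where
  toLinearMap := Φ.toLinearMap + c • Δ
  completelyPositive := h
  trace_preserving X := by simp [Matrix.trace_add, hΔ, Φ.trace_preserving]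

variable {K : Type*} [NormedAddCommGroup K] [InnerProductSpace ℂ K] [CompleteSpace K]
  [DecidableEq a] [DecidableEq b]

theorem ampliation_add_smul (Φ Δ : Matrix a a ℂ →ₗ[ℂ] Matrix b b ℂ) (c : ℂ) :
    ampliation K (Φ + c • Δ) = ampliation K Φ + c • ampliation K Δ := by
  refine LinearMap.ext fun X => ?_
  simp only [LinearMap.add_apply, LinearMap.smul_apply, ampliation_apply, Matrix.add_apply,
    Matrix.smul_apply, add_smul, Finset.sum_add_distrib, map_add, smul_eq_mul, mul_smul,
    ← Finset.smul_sum, map_smul]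

/-- The product rule for `(Φ t ⊗ id) (σ t)`. -/
theorem HasChannelDerivAt.hasAlgebraicDerivAt {Φ : ℝ → MatrixChannel a b}
    {Δ : Matrix a a ℂ →ₗ[ℂ] Matrix b b ℂ} {θ : ℝ} (hΔ : HasChannelDerivAt Φ Δ θ)
    {σ : ℝ → traceClass (Joint a K)} {D : traceClass (Joint a K)}
    (hσ : HasAlgebraicDerivAt σ D θ) :
    HasAlgebraicDerivAt (fun t => ampliation K (Φ t).toLinearMap (σ t))
      (ampliation K Δ (σ θ) + ampliation K (Φ θ).toLinearMap D) θ := by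
  intro g
  simp only [ampliation_apply, map_add, map_sum, map_smul, ← Finset.sum_add_distrib, smul_eq_mul]
  refine HasDerivAt.fun_sum fun k _ => HasDerivAt.fun_sum fun l _ =>
    HasDerivAt.fun_sum fun i _ => HasDerivAt.fun_sum fun j _ => ?_
  exact (hΔ (Matrix.single i j 1) k l).mul (hσ (g ∘ₗ unblock k l ∘ₗ block i j))

/-- A use of the channel adds `1 / ε²` to the Fisher information: `Φ θ` is the equal mixture of
`Φ θ ± ε Δ`, and `Δ` is obtained by giving them the scores `± 1 / ε`. -/
theorem HasScoreDecomposition.applyJoint {Φ : ℝ → MatrixChannel a b} {θ : ℝ}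
    {Δ : Matrix a a ℂ →ₗ[ℂ] Matrix b b ℂ} (hΔ : HasChannelDerivAt Φ Δ θ)
    {ε : ℝ} (hε : 0 < ε)
    (h_plus : IsCompletelyPositive ((Φ θ).toLinearMap + (ε : ℂ) • Δ))
    (h_minus : IsCompletelyPositive ((Φ θ).toLinearMap - (ε : ℂ) • Δ))
    {σ : ℝ → DensityOperator (Joint a K)} {v : ℝ} (h : HasScoreDecomposition σ θ v) :
    HasScoreDecomposition (fun t => (Φ t).applyJoint (σ t)) θ (v + 1 / ε ^ 2) := by
  obtain ⟨ι, _, p, ℓ, τ, hp, h0, h1, hv, hσ, hD⟩ := h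
  -- The sign of the perturbation of the channel `Λ β` below.
  let s : Bool → ℝ := fun β => if β then 1 else -1
  have hcp : ∀ β, IsCompletelyPositive ((Φ θ).toLinearMap + ((s β * ε : ℝ) : ℂ) • Δ) := by
    rintro (_ | _)
    · have : ((s false * ε : ℝ) : ℂ) • Δ = -((ε : ℂ) • Δ) := by
        ext
        simp [s]
      rwa [this, ← sub_eq_add_neg]
    · simpa [s] using h_plus
  let Λ : Bool → MatrixChannel a b := fun β =>
    (Φ θ).perturb Δ _ hΔ.trace_eq_zero (hcp β)
  have hΛ : ∀ β X, ampliation K (Λ β).toLinearMap X =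
      ampliation K (Φ θ).toLinearMap X + ((s β * ε : ℝ) : ℂ) • ampliation K Δ X := fun β X => by
    simp only [Λ, MatrixChannel.perturb]
    rw [ampliation_add_smul]
    rfl
  refine ⟨ι × Bool, inferInstance, fun q => p q.1 / 2, fun q => ℓ q.1 + s q.2 / ε,
    fun q => (Λ q.2).applyJoint (τ q.1), fun q => half_pos (hp _), ?_, ?_, ?_, ?_, ?_⟩
  · rw [Fintype.sum_prod_type, ← h0]
    refine Finset.sum_congr rfl fun i _ => ?_
    simp only [Fintype.sum_bool, s]
    simp
    ring
  · rw [Fintype.sum_prod_type, ← h1]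
    refine Finset.sum_congr rfl fun i _ => ?_
    rw [Fintype.sum_bool, add_halves]
  · have : v + 1 / ε ^ 2 = ∑ i, (p i * ℓ i ^ 2 + p i * (1 / ε ^ 2)) := by
      rw [Finset.sum_add_distrib, ← Finset.sum_mul, hv, h1, one_mul]
    rw [Fintype.sum_prod_type, this]
    refine Finset.sum_congr rfl fun i _ => ?_
    simp only [Fintype.sum_bool, s]
    simp
    ring
  · rw [Fintype.sum_prod_type]
    simp only [MatrixChannel.applyJoint, hσ, map_sum, map_smul, hΛ, Fintype.sum_bool]
    refine Finset.sum_congr rfl fun i _ => ?_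
    simp only [s]
    push_cast
    simp
    module
  · have key := hΔ.hasAlgebraicDerivAt hD
    refine Eq.subst (motive := fun X => HasAlgebraicDerivAt _ X θ) ?_ key
    rw [Fintype.sum_prod_type, hσ]
    simp only [MatrixChannel.applyJoint, map_sum, map_smul, hΛ, Fintype.sum_bool,
      ← Finset.sum_add_distrib]
    refine Finset.sum_congr rfl fun i _ => ?_
    have hε' : (ε : ℂ) ≠ 0 := by exact_mod_cast hε.ne'
    simp only [s]
    push_cast
    simp
    match_scalars <;> field_simp <;> ring

theorem HasScoreDecomposition.alternate {Φ : ℝ → MatrixChannel a b} {θ : ℝ}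
    {Δ : Matrix a a ℂ →ₗ[ℂ] Matrix b b ℂ} (hΔ : HasChannelDerivAt Φ Δ θ)
    {ε : ℝ} (hε : 0 < ε)
    (h_plus : IsCompletelyPositive ((Φ θ).toLinearMap + (ε : ℂ) • Δ))
    (h_minus : IsCompletelyPositive ((Φ θ).toLinearMap - (ε : ℂ) • Δ))
    {σ : ℝ → DensityOperator (Joint b K)} {v : ℝ}
    (h : HasScoreDecomposition σ θ v) :
    ∀ (n : ℕ) (Ψ : Fin n → QuantumChannel (Joint b K) (Joint a K)),
      HasScoreDecomposition (fun t => alternate (Φ t) n Ψ (σ t)) θ (v + n * (1 / ε ^ 2))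
  | 0, _ => by simpa [ChannelEstimation.alternate] using h
  | n + 1, Ψ => by
    have := ((HasScoreDecomposition.alternate hΔ hε h_plus h_minus h n fun k => Ψ k.castSucc).apply
      (Ψ (Fin.last n))).applyJoint hΔ hε h_plus h_minus
    rw [Nat.cast_succ, add_one_mul, ← add_assoc]
    exact this

theorem AdaptiveScheme.hasScoreDecomposition_output {Φ : ℝ → MatrixChannel a b} {θ : ℝ}
    {Δ : Matrix a a ℂ →ₗ[ℂ] Matrix b b ℂ} (hΔ : HasChannelDerivAt Φ Δ θ)
    {ε : ℝ} (hε : 0 < ε)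
    (h_plus : IsCompletelyPositive ((Φ θ).toLinearMap + (ε : ℂ) • Δ))
    (h_minus : IsCompletelyPositive ((Φ θ).toLinearMap - (ε : ℂ) • Δ))
    {n : ℕ} (S : AdaptiveScheme a b K n) :
    HasScoreDecomposition (fun t => S.output (Φ t)) θ ((n + 1 : ℕ) * (1 / ε ^ 2)) := by
  have := HasScoreDecomposition.alternate hΔ hε h_plus h_minus
    (((hasScoreDecomposition_const S.input θ).apply S.first).applyJoint hΔ hε h_plus h_minus)
    n S.next
  rw [zero_add, ← one_add_mul, add_comm, ← Nat.cast_succ] at this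
  exact this

/-- The Cramér–Rao bound for a scheme which uses the channel `n + 1` times. -/
theorem AdaptiveScheme.sq_mul_sq_deriv_le {Φ : ℝ → MatrixChannel a b} {θ : ℝ}
    {Δ : Matrix a a ℂ →ₗ[ℂ] Matrix b b ℂ} (hΔ : HasChannelDerivAt Φ Δ θ)
    {ε : ℝ} (hε : 0 < ε)
    (h_plus : IsCompletelyPositive ((Φ θ).toLinearMap + (ε : ℂ) • Δ))
    (h_minus : IsCompletelyPositive ((Φ θ).toLinearMap - (ε : ℂ) • Δ))
    {n : ℕ} (S : AdaptiveScheme a b K n)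
    (hint : ∀ᶠ t in 𝓝 θ, MeasureTheory.Integrable (fun x : ℝ => x) (S.law (Φ t)))
    {d : ℝ} (hd : HasDerivAt (fun t => S.mean (Φ t)) d θ) :
    ENNReal.ofReal (ε ^ 2 * d ^ 2) ≤ ((n + 1 : ℕ) : ℝ≥0∞) * S.mse (Φ θ) θ := by
  have h := (S.hasScoreDecomposition_output hΔ hε h_plus h_minus).sq_deriv_le (by positivity)
    S.measurement hint hd
  rw [ENNReal.ofReal_mul (sq_nonneg ε)]
  refine (mul_le_mul_right h _).trans_eq ?_
  rw [← mul_assoc, ← ENNReal.ofReal_mul (sq_nonneg ε),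
    show ε ^ 2 * (((n + 1 : ℕ) : ℝ) * (1 / ε ^ 2)) = ((n + 1 : ℕ) : ℝ) by field_simp,
    ENNReal.ofReal_natCast]
  rfl

end Channel

end ChannelEstimation

end

theorem mainTheorem1 {a b : Type*} [Fintype a] [Fintype b] [DecidableEq a] [DecidableEq b]
    (Φ : ℝ → ChannelEstimation.MatrixChannel a b) (θ : ℝ)
    (Δ : Matrix a a ℂ →ₗ[ℂ] Matrix b b ℂ)
    (hΔ : ChannelEstimation.HasChannelDerivAt Φ Δ θ)
    (ε : ℝ) (hε : 0 < ε)
    (h_plus : ChannelEstimation.IsCompletelyPositive ((Φ θ).toLinearMap + (ε : ℂ) • Δ))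
    (h_minus : ChannelEstimation.IsCompletelyPositive ((Φ θ).toLinearMap - (ε : ℂ) • Δ))
    {K : ℕ → Type*} [∀ n, NormedAddCommGroup (K n)] [∀ n, InnerProductSpace ℂ (K n)]
    [∀ n, CompleteSpace (K n)]
    (S : (n : ℕ) → ChannelEstimation.AdaptiveScheme a b (K n) n)
    (hS : ChannelEstimation.AsymptoticallyUnbiasedAt S Φ θ) :
    ENNReal.ofReal (ε ^ 2) ≤
        Filter.liminf (fun n : ℕ => ((n + 1 : ℕ) : ℝ≥0∞) * (S n).mse (Φ θ) θ) Filter.atTop ∧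
      ∀ C : ℝ≥0, ∀ᶠ n : ℕ in Filter.atTop,
        (C : ℝ≥0∞) / ((n + 1 : ℕ) : ℝ≥0∞) ^ 2 < (S n).mse (Φ θ) θ := by
  obtain ⟨d, hd, hd1⟩ := hS.tendsto_deriv
  have hlim : Filter.Tendsto (fun n => ENNReal.ofReal (ε ^ 2 * d n ^ 2)) Filter.atTop
      (𝓝 (ENNReal.ofReal (ε ^ 2))) := by
    simpa using ENNReal.tendsto_ofReal ((hd1.pow 2).const_mul (ε ^ 2))
  have hle : ENNReal.ofReal (ε ^ 2) ≤
      Filter.liminf (fun n : ℕ => ((n + 1 : ℕ) : ℝ≥0∞) * (S n).mse (Φ θ) θ) Filter.atTop := by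
    rw [← hlim.liminf_eq]
    refine Filter.liminf_le_liminf ?_
    filter_upwards [hS.integrable, hd] with n hn hdn
    exact (S n).sq_mul_sq_deriv_le hΔ hε h_plus h_minus hn hdn
  refine ⟨hle, fun C => ?_⟩
  have hC : Filter.Tendsto (fun n : ℕ => (C : ℝ≥0∞) / ((n + 1 : ℕ) : ℝ≥0∞)) Filter.atTop
      (𝓝 0) :=
    ENNReal.div_top (a := (C : ℝ≥0∞)) ▸ (ENNReal.Tendsto.const_div ENNReal.tendsto_nat_nhds_top
      (Or.inr ENNReal.coe_ne_top)).comp (Filter.tendsto_add_atTop_nat 1)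
  -- `(n + 1) * mse` eventually exceeds `ε ^ 2 / 2`, hence also `C / (n + 1)`.
  have hpos : 0 < ENNReal.ofReal (ε ^ 2) / 2 :=
    ENNReal.div_pos (by simpa using hε.ne') (by simp)
  have hlt : ENNReal.ofReal (ε ^ 2) / 2 < Filter.liminf
      (fun n : ℕ => ((n + 1 : ℕ) : ℝ≥0∞) * (S n).mse (Φ θ) θ) Filter.atTop :=
    (ENNReal.half_lt_self (by simpa using hε.ne') ENNReal.ofReal_ne_top).trans_le hle
  filter_upwards [hC.eventually_lt_const hpos, Filter.eventually_lt_of_lt_liminf hlt] with n h1 h2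
  have h0 : ((n + 1 : ℕ) : ℝ≥0∞) ≠ 0 := by exact_mod_cast n.succ_ne_zero
  have ht : ((n + 1 : ℕ) : ℝ≥0∞) ≠ ∞ := ENNReal.natCast_ne_top _
  rw [pow_two, div_eq_mul_inv, ENNReal.mul_inv (Or.inl h0) (Or.inl ht), ← mul_assoc,
    ← div_eq_mul_inv, ← div_eq_mul_inv]
  exact ENNReal.div_lt_of_lt_mul' (h1.trans h2)
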